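/- Let $M_k$ be the space of complex $k\times k$ matrices with inner product $\langle X,Y\rangle=\mathrm{tr}(XY^*)$, and identify $M_k\otimes M_k$ with $M_{k^2}$ via the Kronecker product; "positive semidefinite" includes Hermitian. For $A=\sum_{i}A_i\otimes B_i\in M_k\otimes M_k$ define $F_A,G_A:M_k\to M_k$ by $F_A(X)=\sum_i \mathrm{tr}(B_iX)A_i$ and $G_A(X)=\sum_i\mathrm{tr}(A_iX)B_i$. A matrix $A=\sum_i A_i\otimes B_i$ is PPT if $A$ and its partial transpose $\sum_i A_i\otimes B_i^t$ are positive semidefinite. For a permutation $\sigma\in S_4$ let $L_\sigma:M_k\otimes M_k\to M_k\otimes M_k$ be the linear map with $L_\sigma(a_1a_2^t\otimes a_3a_4^t)=a_{\sigma(1)}a_{\sigma(2)}^t\otimes a_{\sigma(3)}a_{\sigma(4)}^t$ for all $a_1,a_2,a_3,a_4\in\mathbb{C}^k$, and let $I_\sigma=\{A\in M_k\otimes M_k : A \text{ is positive semidefinite and } A=L_\sigma(A)\}$. For an orthogonal projection $V\in M_k$ let $VM_kV=\{VXV: X\in M_k\}$. A linear map $L:VM_kV\to VM_kV$ is positive if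 it maps positive semidefinite matrices to positive semidefinite matrices. A non-null positive map $L:VM_kV\to VM_kV$ is irreducible if for every orthogonal projection $W$ with $WM_kW\subset VM_kV$ and $L(WM_kW)\subset WM_kW$ one has $W=V$ or $W=0$. A positive map $L:M_k\to M_k$ is completely reducible if there are $s\ge 0$, orthogonal projections $V_1,\dots,V_s\in M_k$ with $V_iV_j=0$ for $i\ne j$, and a subspace $R$ with $M_k=V_1M_kV_1\oplus\dots\oplus V_sM_kV_s\oplus R$ and $R\perp V_1M_kV_1\oplus\dots\oplus V_sM_kV_s$, such that, for every $i$, $L(V_iM_kV_i)\subset V_iM_kV_i$ and $L|_{V_iM_kV_i}$ is irreducible, and $L|_R\equiv 0$. Theorem. Let $k=2$ and $\sigma\in S_4$. If $F_A\circ G_A:M_2\to M_2$ is completely reducible for every $A\in I_\sigma$, then every $A\in I_\sigma$ is PPT. -/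

import Mathlib

open Matrix
open scoped Kronecker ComplexOrder

/-- The set `V M_k V = {V X V : X ∈ M_k}`, as a subspace of `M_k`. -/
def corner {n : Type*} [Fintype n] [DecidableEq n] (V : Matrix n n ℂ) :
    Submodule ℂ (Matrix n n ℂ) :=
  LinearMap.range (LinearMap.mulLeftRight ℂ (V, V))

theorem mem_corner {n : Type*} [Fintype n] [DecidableEq n] (V Y : Matrix n n ℂ) :
    Y ∈ corner V ↔ ∃ X : Matrix n n ℂ, V * X * V = Y := by
  simp [corner, LinearMap.mem_range, LinearMap.mulLeftRight_apply]

/-- `L : V M_k V → V M_k V` is a positive map: it maps `V M_k V` into itself, and the positive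
semidefinite matrices of `V M_k V` to positive semidefinite matrices. -/
def IsPositiveMapOn {n : Type*} [Fintype n] [DecidableEq n]
    (L : Matrix n n ℂ →ₗ[ℂ] Matrix n n ℂ) (V : Matrix n n ℂ) : Prop :=
  (∀ X ∈ corner V, L X ∈ corner V) ∧ ∀ X ∈ corner V, X.PosSemidef → (L X).PosSemidef

/-- `L|_{V M_k V}` is irreducible: it is a non-null positive map `V M_k V → V M_k V`, and the only
`W M_k W ⊆ V M_k V` (`W` an orthogonal projection) which it leaves invariant are
those with `W = V` or `W = 0`. -/
def IsIrreducibleOn {n : Type*} [Fintype n] [DecidableEq n]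
    (L : Matrix n n ℂ →ₗ[ℂ] Matrix n n ℂ) (V : Matrix n n ℂ) : Prop :=
  IsPositiveMapOn L V ∧ (∃ X ∈ corner V, L X ≠ 0) ∧
    ∀ W : Matrix n n ℂ, IsStarProjection W → corner W ≤ corner V →
      (∀ X ∈ corner W, L X ∈ corner W) → W = V ∨ W = 0

/-- `L : V M_k V → V M_k V` is completely reducible.  The number `s` of summands may be `0`, which
is the case for the zero map. -/
def IsCompletelyReducibleOn {n : Type*} [Fintype n] [DecidableEq n]
    (L : Matrix n n ℂ →ₗ[ℂ] Matrix n n ℂ) (V : Matrix n n ℂ) : Prop :=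
  IsPositiveMapOn L V ∧
    ∃ (s : ℕ) (P : Fin s → Matrix n n ℂ) (R : Submodule ℂ (Matrix n n ℂ)),
      (∀ i, IsStarProjection (P i)) ∧
      (∀ i j, i ≠ j → P i * P j = 0) ∧
      (∀ i, P i * V = P i) ∧
      -- `V M_k V` is the direct sum of the `P i M_k P i` and `R`
      iSupIndep (fun i => corner (P i)) ∧
      Disjoint (⨆ i, corner (P i)) R ∧
      (⨆ i, corner (P i)) ⊔ R = corner V ∧
      -- orthogonality with respect to `⟨X, Y⟩ = tr (X Y^*)`
      (∀ X ∈ R, ∀ Y ∈ ⨆ i, corner (P i), (X * Yᴴ).trace = 0) ∧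
      (∀ i, ∀ X ∈ corner (P i), L X ∈ corner (P i)) ∧
      (∀ i, IsIrreducibleOn L (P i)) ∧
      (∀ X ∈ R, L X = 0)

/-- A linear map `L : M_k → M_k` is completely reducible (the case `V = Id`). -/
def IsCompletelyReducible {n : Type*} [Fintype n] [DecidableEq n]
    (L : Matrix n n ℂ →ₗ[ℂ] Matrix n n ℂ) : Prop :=
  IsCompletelyReducibleOn L 1

/-- `F_A : M_m → M_k`, `F_A(X) = ∑ i, tr(B_i X) A_i` for `A = ∑ i, A_i ⊗ B_i`, written in
coordinates; see `mapF_sum_kronecker`. -/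
def mapF {m n : Type*} [Fintype m] [Fintype n] (A : Matrix (m × n) (m × n) ℂ) :
    Matrix n n ℂ →ₗ[ℂ] Matrix m m ℂ where
  toFun X := Matrix.of fun i j => ∑ p, ∑ q, A (i, p) (j, q) * X q p
  map_add' X Y := by
    ext i j
    simp [mul_add, Finset.sum_add_distrib]
  map_smul' c X := by
    ext i j
    simp [Finset.mul_sum, mul_left_comm]

/-- `G_A : M_k → M_m`, `G_A(X) = ∑ i, tr(A_i X) B_i` for `A = ∑ i, A_i ⊗ B_i`, written in
coordinates; see `mapG_sum_kronecker`. -/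
def mapG {m n : Type*} [Fintype m] [Fintype n] (A : Matrix (m × n) (m × n) ℂ) :
    Matrix m m ℂ →ₗ[ℂ] Matrix n n ℂ where
  toFun X := Matrix.of fun p q => ∑ i, ∑ j, A (i, p) (j, q) * X j i
  map_add' X Y := by
    ext i j
    simp [mul_add, Finset.sum_add_distrib]
  map_smul' c X := by
    ext i j
    simp [Finset.mul_sum, mul_left_comm]

theorem mapF_sum_kronecker {ι m n : Type*} [Fintype ι] [Fintype m] [Fintype n]
    (A : ι → Matrix m m ℂ) (B : ι → Matrix n n ℂ) (X : Matrix n n ℂ) :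
    mapF (∑ i, A i ⊗ₖ B i) X = ∑ i, (B i * X).trace • A i := by
  ext a b
  simp only [mapF, LinearMap.coe_mk, AddHom.coe_mk, of_apply, Matrix.sum_apply,
    kroneckerMap_apply, Finset.sum_mul, Matrix.smul_apply, smul_eq_mul, trace, diag_apply,
    mul_apply]
  rw [Finset.sum_congr rfl fun p _ => Finset.sum_comm, Finset.sum_comm]
  exact Finset.sum_congr rfl fun i _ => Finset.sum_congr rfl fun p _ =>
    Finset.sum_congr rfl fun q _ => by ring

theorem mapG_sum_kronecker {ι m n : Type*} [Fintype ι] [Fintype m] [Fintype n]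
    (A : ι → Matrix m m ℂ) (B : ι → Matrix n n ℂ) (X : Matrix m m ℂ) :
    mapG (∑ i, A i ⊗ₖ B i) X = ∑ i, (A i * X).trace • B i := by
  ext a b
  simp only [mapG, LinearMap.coe_mk, AddHom.coe_mk, of_apply, Matrix.sum_apply,
    kroneckerMap_apply, Finset.sum_mul, Matrix.smul_apply, smul_eq_mul, trace, diag_apply,
    mul_apply]
  rw [Finset.sum_congr rfl fun p _ => Finset.sum_comm, Finset.sum_comm]
  exact Finset.sum_congr rfl fun i _ => Finset.sum_congr rfl fun p _ =>
    Finset.sum_congr rfl fun q _ => by ring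

/-- The partial transposition `∑ i, A_i ⊗ B_i ↦ ∑ i, A_i ⊗ B_iᵗ`. -/
def partialTranspose {m n : Type*} (A : Matrix (m × n) (m × n) ℂ) :
    Matrix (m × n) (m × n) ℂ :=
  Matrix.of fun x y => A (x.1, y.2) (y.1, x.2)

theorem partialTranspose_sum_kronecker {ι m n : Type*} [Fintype ι]
    (A : ι → Matrix m m ℂ) (B : ι → Matrix n n ℂ) :
    partialTranspose (∑ i, A i ⊗ₖ B i) = ∑ i, A i ⊗ₖ (B i)ᵀ := by
  ext x y
  simp [partialTranspose, Matrix.sum_apply]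

/-- `A` is PPT: `A` and its partial transpose are positive semidefinite Hermitian. -/
def IsPPT {m n : Type*} (A : Matrix (m × n) (m × n) ℂ) : Prop :=
  A.PosSemidef ∧ (partialTranspose A).PosSemidef

/-- The linear map `L_σ : M_k ⊗ M_k → M_k ⊗ M_k` determined by
`L_σ(a₁ a₂ᵗ ⊗ a₃ a₄ᵗ) = a_{σ(1)} a_{σ(2)}ᵗ ⊗ a_{σ(3)} a_{σ(4)}ᵗ`, written in coordinates; see
`permMap_kronecker`. Here `1, 2, 3, 4` are the elements `0, 1, 2, 3` of `Fin 4`. -/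
def permMap {n : Type*} (σ : Equiv.Perm (Fin 4)) :
    Matrix (n × n) (n × n) ℂ →ₗ[ℂ] Matrix (n × n) (n × n) ℂ where
  toFun A := Matrix.of fun x y =>
    let t : Fin 4 → n := ![x.1, y.1, x.2, y.2]
    A (t (σ⁻¹ 0), t (σ⁻¹ 2)) (t (σ⁻¹ 1), t (σ⁻¹ 3))
  map_add' _ _ := rfl
  map_smul' _ _ := rfl

theorem permMap_kronecker {n : Type*} (σ : Equiv.Perm (Fin 4)) (a : Fin 4 → n → ℂ) :
    permMap σ (vecMulVec (a 0) (a 1) ⊗ₖ vecMulVec (a 2) (a 3)) =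
      vecMulVec (a (σ 0)) (a (σ 1)) ⊗ₖ vecMulVec (a (σ 2)) (a (σ 3)) := by
  ext x y
  have h := Equiv.prod_comp σ
    (fun j => a j ((![x.1, y.1, x.2, y.2] : Fin 4 → n) (σ⁻¹ j)))
  simp only [Fin.prod_univ_four, Equiv.Perm.inv_def, Equiv.symm_apply_apply] at h
  change a 0 _ * a 1 _ * (a 2 _ * a 3 _) =
    a (σ 0) x.1 * a (σ 1) y.1 * (a (σ 2) x.2 * a (σ 3) y.2)
  rw [← mul_assoc, ← mul_assoc]
  exact h.symm

/-- `I_σ`: the positive semidefinite matrices `A ∈ M_k ⊗ M_k` with `A = L_σ(A)`. -/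
def setI (n : Type*) (σ : Equiv.Perm (Fin 4)) : Set (Matrix (n × n) (n × n) ℂ) :=
  {A | A.PosSemidef ∧ A = permMap σ A}

/-! View `A` as a tensor with four binary indices. Its invariance group contains `σ` and, since `A`
is Hermitian, the conjugate of `σ` by the index permutation of transposition. If `σ` preserves the
pairing that defines the maximally entangled state, that state lies in `I_σ` and gives `F_A ∘ G_A =
id`, which is not completely reducible, so the hypothesis fails. Otherwise (`perm_symmetry_cases`)
`A` is symmetric in the indices of one tensor factor, so its partial transpose is `A` or `Aᵀ`, or
`A` is invariant under realignment, where `IsPPT.of_realignment` applies. -/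

/-! ### The identity map is not completely reducible -/

/-- Matrix rings over a domain are prime. -/
theorem Matrix.eq_zero_or_eq_zero_of_forall_mul_mul {n R : Type*} [Fintype n] [DecidableEq n]
    [CommRing R] [IsDomain R] {P Q : Matrix n n R} (h : ∀ X : Matrix n n R, P * X * Q = 0) :
    P = 0 ∨ Q = 0 := by
  by_contra! hne
  obtain ⟨hP, hQ⟩ := hne
  obtain ⟨a, i, hai⟩ : ∃ a i, P a i ≠ 0 := by
    by_contra! h0
    exact hP (Matrix.ext h0)
  obtain ⟨j, b, hjb⟩ : ∃ j b, Q j b ≠ 0 := by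
    by_contra! h0
    exact hQ (Matrix.ext h0)
  have hX := congrFun (congrFun (h (vecMulVec (Pi.single i 1) (Pi.single j 1))) a) b
  simp [mul_vecMulVec, vecMulVec_mul, vecMulVec_apply] at hX
  tauto

theorem corner_one {n : Type*} [Fintype n] [DecidableEq n] :
    corner (1 : Matrix n n ℂ) = ⊤ := by
  ext X
  simp [mem_corner]

/-- The identity has no kernel, so `R = 0` and the orthogonal corners must fill the whole matrix
ring. Primeness then leaves a single corner `P i = 1`, on which the identity preserves every smaller
corner. -/
theorem not_isCompletelyReducible_id :
    ¬ IsCompletelyReducible (LinearMap.id : Matrix (Fin 2) (Fin 2) ℂ →ₗ[ℂ] _) := by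
  rintro ⟨-, s, P, R, hP, horth, -, -, -, htop, -, -, hirr, hR⟩
  have hR0 : R = ⊥ := (Submodule.eq_bot_iff R).2 hR
  rw [hR0, sup_bot_eq, corner_one] at htop
  rcases isEmpty_or_nonempty (Fin s) with hs | ⟨⟨i⟩⟩
  · rw [iSup_of_empty] at htop
    exact bot_ne_top htop
  have hidem : P i * P i = P i := (hP i).isIdempotentElem
  -- Every summand is block diagonal with respect to `P i`, hence so is every matrix.
  have hzero : ∀ X, P i * X * (1 - P i) = 0 := by
    intro X
    have hle : (⨆ j, corner (P j)) ≤ LinearMap.ker (LinearMap.mulLeftRight ℂ (P i, 1 - P i)) := by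
      refine iSup_le fun j Y hY => ?_
      obtain ⟨Z, rfl⟩ := (mem_corner _ _).1 hY
      rw [LinearMap.mem_ker, LinearMap.mulLeftRight_apply]
      by_cases hij : i = j
      · subst hij
        simp only [mul_assoc, mul_sub, mul_one, hidem, sub_self]
      · simp only [← mul_assoc, horth i j hij, zero_mul]
    have hX : X ∈ ⨆ j, corner (P j) := htop ▸ Submodule.mem_top
    simpa [LinearMap.mulLeftRight_apply] using hle hX
  obtain ⟨-, ⟨X, hX, hX0⟩, hmin⟩ := hirr i
  rcases eq_zero_or_eq_zero_of_forall_mul_mul hzero with h0 | h1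
  · obtain ⟨Y, rfl⟩ := (mem_corner _ _).1 hX
    simp [h0] at hX0
  · have h1 : P i = 1 := (sub_eq_zero.1 h1).symm
    have hW : IsStarProjection (diagonal ![1, 0] : Matrix (Fin 2) (Fin 2) ℂ) := by
      refine ⟨?_, ?_⟩
      · ext a b
        fin_cases a <;> fin_cases b <;> simp [Matrix.mul_apply]
      · ext a b
        fin_cases a <;> fin_cases b <;> simp
    rcases hmin _ hW (by rw [h1, corner_one]; exact le_top) (fun _ h => h) with h | h
    · simpa [h1] using congrFun (congrFun h 1) 1
    · simpa using congrFun (congrFun h 0) 0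

/-! ### The maximally entangled state -/

/-- The (unnormalized) projection onto the maximally entangled vector `∑ i, e_i ⊗ e_i`. -/
def maxEntangled (n : Type*) [DecidableEq n] : Matrix (n × n) (n × n) ℂ :=
  Matrix.of fun x y => if x.1 = x.2 ∧ y.1 = y.2 then 1 else 0

theorem maxEntangled_posSemidef (n : Type*) [DecidableEq n] [Fintype n] :
    (maxEntangled n).PosSemidef := by
  convert posSemidef_vecMulVec_self_star (fun x : n × n => if x.1 = x.2 then (1 : ℂ) else 0)
  ext x y
  by_cases hx : x.1 = x.2 <;> by_cases hy : y.1 = y.2 <;>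
    simp [maxEntangled, vecMulVec_apply, hx, hy]

/-- Here `A = ∑ E_ij ⊗ E_ij`, so both maps are transposition. -/
theorem mapF_comp_mapG_maxEntangled (n : Type*) [DecidableEq n] [Fintype n] :
    mapF (maxEntangled n) ∘ₗ mapG (maxEntangled n) = LinearMap.id := by
  ext1 X
  ext i j
  simp [mapF, mapG, maxEntangled, ite_and]

/-! ### Positivity of the partial transpose -/

theorem IsPPT.of_symm_right {m n : Type*} {A : Matrix (m × n) (m × n) ℂ} (hA : A.PosSemidef)
    (h : ∀ i j p q, A (i, q) (j, p) = A (i, p) (j, q)) : IsPPT A := by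
  refine ⟨hA, ?_⟩
  have : partialTranspose A = A := by
    ext x y
    exact h _ _ _ _
  rwa [this]

theorem IsPPT.of_symm_left {m n : Type*} {A : Matrix (m × n) (m × n) ℂ} (hA : A.PosSemidef)
    (h : ∀ i j p q, A (j, p) (i, q) = A (i, p) (j, q)) : IsPPT A := by
  refine ⟨hA, ?_⟩
  have : partialTranspose A = Aᵀ := by
    ext x y
    exact (h _ _ _ _).symm
  rw [this]
  exact hA.transpose

theorem exists_mul_eq_of_det_eq_zero {K : Type*} [Field K] {a b c d : K}
    (h : a * d - b * c = 0) :
    ∃ x y : Fin 2 → K, x 0 * y 0 = a ∧ x 0 * y 1 = b ∧ x 1 * y 0 = c ∧ x 1 * y 1 = d := by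
  by_cases ha : a = 0
  · subst ha
    rcases mul_eq_zero.1 (show b * c = 0 by linear_combination -h) with rfl | rfl
    · exact ⟨![0, 1], ![c, d], by simp⟩
    · exact ⟨![b, d], ![0, 1], by simp⟩
  · refine ⟨![1, c / a], ![a, b], by simp, by simp, ?_, ?_⟩
    · simp [ha]
    · simp only [cons_val_one, cons_val_zero]
      field_simp
      linear_combination -h

/-- Every vector of `ℂ² ⊗ ℂ²` is a product vector up to an antisymmetric one. -/
theorem exists_product_add_antisymm (w : Fin 2 × Fin 2 → ℂ) :
    ∃ (c : ℂ) (x y : Fin 2 → ℂ), w (0, 0) = x 0 * y 0 ∧ w (0, 1) = x 0 * y 1 - c ∧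
      w (1, 0) = x 1 * y 0 + c ∧ w (1, 1) = x 1 * y 1 := by
  -- The shift `c` must make the 2×2 coefficient matrix of `w` singular, which is a monic quadratic
  -- equation in `c`.
  obtain ⟨s, hs⟩ := IsAlgClosed.exists_pow_nat_eq
    (discrim 1 (w (0, 1) - w (1, 0)) (w (0, 0) * w (1, 1) - w (0, 1) * w (1, 0))) two_pos
  obtain ⟨c, hc⟩ := exists_quadratic_eq_zero one_ne_zero ⟨s, by rw [← hs, sq]⟩
  obtain ⟨x, y, h00, h01, h10, h11⟩ := exists_mul_eq_of_det_eq_zero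
    (show w (0, 0) * w (1, 1) - (w (0, 1) + c) * (w (1, 0) - c) = 0 by linear_combination hc)
  exact ⟨c, x, y, h00.symm, by rw [h01]; ring, by rw [h10]; ring, h11.symm⟩

/-- A realignment invariant positive semidefinite matrix of `M₂ ⊗ M₂` is PPT: its partial transpose
vanishes on the antisymmetric vector, and it is nonnegative on product vectors. -/
theorem IsPPT.of_realignment {A : Matrix (Fin 2 × Fin 2) (Fin 2 × Fin 2) ℂ} (hA : A.PosSemidef)
    (h₁ : ∀ i j p q, A (q, p) (j, i) = A (i, p) (j, q))
    (h₂ : ∀ i j p q, A (i, j) (p, q) = A (i, p) (j, q)) : IsPPT A := by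
  refine ⟨hA, PosSemidef.of_dotProduct_mulVec_nonneg ?_ fun w => ?_⟩
  · ext x y
    exact hA.1.apply _ _
  obtain ⟨c, x, y, h00, h01, h10, h11⟩ := exists_product_add_antisymm w
  -- The partial transpose at `x ⊗ y` has the same quadratic form as `A` at `x ⊗ ȳ`; the terms in
  -- `c` cancel by the symmetries.
  have hz := hA.dotProduct_mulVec_nonneg fun z => x z.1 * star (y z.2)
  convert hz using 1
  simp only [dotProduct, mulVec, partialTranspose, Fintype.sum_prod_type, Fin.sum_univ_two,
    Pi.star_apply, of_apply, h00, h01, h10, h11, star_mul', star_sub, star_add, star_star,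
    h₂ 0 1 0 0, h₂ 1 1 0 0, h₂ 0 1 0 1, h₂ 1 1 0 1, h₁ 0 0 0 1, h₁ 0 1 0 1, h₁ 0 1 1 1]
  ring

/-! ### Symmetries of tensors over a two-element set -/

/-- The entries of a matrix in `M_k ⊗ M_k` as a tensor with four indices. -/
def tensorEntry {n : Type*} (A : Matrix (n × n) (n × n) ℂ) (t : Fin 4 → n) : ℂ :=
  A (t 0, t 2) (t 1, t 3)

/-- The permutation of the tensor indices which corresponds to transposing a matrix. -/
def transposePerm : Equiv.Perm (Fin 4) := Equiv.swap 0 1 * Equiv.swap 2 3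

/-- A permutation of the four indices preserves the pairing `{0, 2}, {1, 3}`, or together with its
conjugate by `transposePerm` it generates, on tensors over a two-element set, the symmetry
under `(2 3)`, or under `(0 1)`, or under `(0 3)` and `(1 2)`. -/
theorem perm_symmetry_cases (σ : Equiv.Perm (Fin 4)) :
    (∀ t : Fin 4 → Fin 2, (t (σ 0) = t (σ 2) ∧ t (σ 1) = t (σ 3)) ↔ (t 0 = t 2 ∧ t 1 = t 3)) ∨
    (∀ t : Fin 4 → Fin 2, ∃ a b : Fin 3, ∀ l, t (Equiv.swap 2 3 l) =
      t ((σ ^ a.1 * (transposePerm * σ * transposePerm) ^ b.1) l)) ∨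
    (∀ t : Fin 4 → Fin 2, ∃ a b : Fin 3, ∀ l, t (Equiv.swap 0 1 l) =
      t ((σ ^ a.1 * (transposePerm * σ * transposePerm) ^ b.1) l)) ∨
    ((∀ t : Fin 4 → Fin 2, ∃ a b : Fin 3, ∀ l, t (Equiv.swap 0 3 l) =
      t ((σ ^ a.1 * (transposePerm * σ * transposePerm) ^ b.1) l)) ∧
     (∀ t : Fin 4 → Fin 2, ∃ a b : Fin 3, ∀ l, t (Equiv.swap 1 2 l) =
      t ((σ ^ a.1 * (transposePerm * σ * transposePerm) ^ b.1) l))) := by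
  revert σ
  decide +kernel

/-- The permutations of the indices which leave the entries of `A` unchanged. -/
def tensorStabilizer {n : Type*} (A : Matrix (n × n) (n × n) ℂ) :
    Submonoid (Equiv.Perm (Fin 4)) where
  carrier := {τ | ∀ t : Fin 4 → n, tensorEntry A (t ∘ τ) = tensorEntry A t}
  one_mem' _ := rfl
  mul_mem' {τ₁ _} h₁ h₂ t := (h₂ (t ∘ τ₁)).trans (h₁ t)

theorem mem_tensorStabilizer_of_eq_permMap {n : Type*} {A : Matrix (n × n) (n × n) ℂ}
    {σ : Equiv.Perm (Fin 4)} (h : A = permMap σ A) : σ ∈ tensorStabilizer A := by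
  intro t
  have ht : (![(t ∘ σ) 0, (t ∘ σ) 1, (t ∘ σ) 2, (t ∘ σ) 3] : Fin 4 → n) = t ∘ σ := by
    ext l
    fin_cases l <;> rfl
  have key : tensorEntry A (t ∘ σ) = tensorEntry (permMap σ A) (t ∘ σ) := by rw [← h]
  rw [key]
  change tensorEntry A (![(t ∘ σ) 0, (t ∘ σ) 1, (t ∘ σ) 2, (t ∘ σ) 3] ∘ σ.symm) = _
  rw [ht, Function.comp_assoc, Equiv.self_comp_symm, Function.comp_id]

theorem tensorEntry_comp_transposePerm {n : Type*} {A : Matrix (n × n) (n × n) ℂ}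
    (hA : A.IsHermitian) (t : Fin 4 → n) :
    tensorEntry A (t ∘ transposePerm) = star (tensorEntry A t) :=
  (hA.apply (t 1, t 3) (t 0, t 2)).symm

/-- Each `transposePerm` conjugates the entry, and the two conjugations cancel. -/
theorem conj_transposePerm_mem_tensorStabilizer {n : Type*} {A : Matrix (n × n) (n × n) ℂ}
    (hA : A.IsHermitian) {σ : Equiv.Perm (Fin 4)} (hσ : σ ∈ tensorStabilizer A) :
    transposePerm * σ * transposePerm ∈ tensorStabilizer A := by
  intro t
  change tensorEntry A (((t ∘ transposePerm) ∘ σ) ∘ transposePerm) = _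
  rw [tensorEntry_comp_transposePerm hA, hσ, tensorEntry_comp_transposePerm hA, star_star]

/-- The exponents may depend on `t`: only orbits of index tuples matter, so `τ` need not lie in the
generated group. For binary indices this gains symmetries, for instance transpositions from
3-cycles. -/
theorem mem_tensorStabilizer_of_orbits {n : Type*} {A : Matrix (n × n) (n × n) ℂ}
    (hA : A.IsHermitian) {σ τ : Equiv.Perm (Fin 4)} (hσ : σ ∈ tensorStabilizer A)
    (h : ∀ t : Fin 4 → n, ∃ a b : Fin 3, ∀ l, t (τ l) =
      t ((σ ^ a.1 * (transposePerm * σ * transposePerm) ^ b.1) l)) :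
    τ ∈ tensorStabilizer A := by
  intro t
  obtain ⟨a, b, hab⟩ := h t
  rw [show t ∘ τ = t ∘ _ from funext hab]
  exact mul_mem (pow_mem hσ _)
    (pow_mem (conj_transposePerm_mem_tensorStabilizer hA hσ) _) t

theorem mainTheorem8 (σ : Equiv.Perm (Fin 4))
    (h : ∀ A ∈ setI (Fin 2) σ, IsCompletelyReducible (mapF A ∘ₗ mapG A)) :
    setI (Fin 2) σ ⊆ {A : Matrix (Fin 2 × Fin 2) (Fin 2 × Fin 2) ℂ | IsPPT A} := by
  rintro A ⟨hA, hAσ⟩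
  have hσ := mem_tensorStabilizer_of_eq_permMap hAσ
  rcases perm_symmetry_cases σ with hc | hc | hc | ⟨hc₁, hc₂⟩
  · refine absurd (h (maxEntangled (Fin 2)) ⟨maxEntangled_posSemidef _, ?_⟩) ?_
    · ext x y
      have hxy := hc (![x.1, y.1, x.2, y.2] ∘ σ.symm)
      simp only [Function.comp_apply, Equiv.symm_apply_apply] at hxy
      exact if_congr hxy rfl rfl
    · rw [mapF_comp_mapG_maxEntangled]
      exact not_isCompletelyReducible_id
  · have hs := mem_tensorStabilizer_of_orbits hA.1 hσ hc
    exact IsPPT.of_symm_right hA fun i j p q => hs ![i, j, p, q]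
  · have hs := mem_tensorStabilizer_of_orbits hA.1 hσ hc
    exact IsPPT.of_symm_left hA fun i j p q => hs ![i, j, p, q]
  · have hs₁ := mem_tensorStabilizer_of_orbits hA.1 hσ hc₁
    have hs₂ := mem_tensorStabilizer_of_orbits hA.1 hσ hc₂
    exact IsPPT.of_realignment hA (fun i j p q => hs₁ ![i, j, p, q])
      fun i j p q => hs₂ ![i, j, p, q]
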